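/- Let $d\ge 1$ and let $\Omega\subset\mathbb{R}^d$ be a nonempty bounded open set (for example a bounded domain). Let $\sigma:\mathbb{R}\to(0,\infty)$ be injective and $C^\infty$, and let $c\ge 0$. Let $\mathcal{P}_s(\Omega)$ be the set of finite signed Borel measures $\mu$ on $\mathbb{R}^d$ that vanish outside some compact subset of $\Omega$, are absolutely continuous with respect to Lebesgue measure, with density $f=d\mu/dx$, and satisfy $\int_\Omega \sigma(f(\tau))\,d\tau<\infty$ (which is automatic if $f$ is bounded); identify $\mu$ with $f$. For $f\in\mathcal{P}_s(\Omega)$ put $$ (P_\sigma f)(t)=\frac{\sigma(f(t))+c}{\int_\Omega(\sigma(f(\tau))+c)\,d\tau},\qquad t\in\Omega, $$ and for $f,g\in\mathcal{P}_s(\Omega)$ put $W_\sigma(f,g)=W_2(P_\sigma f,P_\sigma g)$, where $$ W_2(\mu,\nu)=\Bigl(\inf_{\pi}\int_{\mathbb{R}^d\times\mathbb{R}^d}|x-y|^2\,d\pi(x,y)\Bigr)^{1/2}, $$ the infimum being over all Borel measures $\pi$ on $\mathbb{R}^d\times\mathbb{R}^d$ with marginals $\mu$ and $\nu$, and $P_\sigma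 f$ is regarded as the measure on $\Omega$ with that density. Then $P_\sigma f$ is a probability density with finite second moment for every $f\in\mathcal{P}_s(\Omega)$, and $W_\sigma$ is a metric on $\mathcal{P}_s(\Omega)$: it is finite, nonnegative and symmetric, it satisfies the triangle inequality, and $W_\sigma(f,g)=0$ if and only if $f=g$ (as measures, i.e. almost everywhere). -/

import Mathlib

open MeasureTheory Set
open scoped ENNReal ContDiff

noncomputable section

namespace SignedW2

/-- `ℝ^d` with the Euclidean norm. -/
abbrev E (d : ℕ) : Type := EuclideanSpace ℝ (Fin d)

/-- The conditions on a scaling function: `σ : ℝ → ℝ⁺` is one-to-one and `C^∞`. -/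
structure IsScaling (σ : ℝ → ℝ) : Prop where
  pos : ∀ y, 0 < σ y
  injective : Function.Injective σ
  smooth : ContDiff ℝ ∞ σ

/-- The set `Γ(μ, ν)` of transference plans: measures on the product with marginals `μ` and `ν`. -/
def plans {X : Type*} [MeasurableSpace X] (μ ν : Measure X) : Set (Measure (X × X)) :=
  {π | π.map Prod.fst = μ ∧ π.map Prod.snd = ν}

/-- The quadratic Wasserstein distance
`W₂(μ, ν) = (inf_{π ∈ Γ(μ, ν)} ∫ |x - y|² dπ(x, y))^{1/2}`, with values in `[0, ∞]`. -/
def W2 {X : Type*} [MeasurableSpace X] [PseudoEMetricSpace X] (μ ν : Measure X) : ℝ≥0∞ :=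
  (⨅ π ∈ plans μ ν, ∫⁻ z, edist z.1 z.2 ^ 2 ∂π) ^ (1 / 2 : ℝ)

variable {d : ℕ}

/-- The (Lebesgue) density `f = dμ` of a signed measure. -/
def density (μ : SignedMeasure (E d)) : E d → ℝ := μ.rnDeriv volume

/-- The signed measure `μ` is compactly supported in `Ω`: it vanishes off a compact subset
of `Ω`. -/
def CompactlySupportedIn (Ω : Set (E d)) (μ : SignedMeasure (E d)) : Prop :=
  ∃ K : Set (E d), IsCompact K ∧ K ⊆ Ω ∧ ∀ A, MeasurableSet A → Disjoint A K → μ A = 0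

/-- The signals on `Ω`: finite signed measures that are compactly supported in `Ω`, have a density
`f` with respect to Lebesgue measure, and lie in the domain of the normalization operator, i.e.
the total mass `∫_Ω σ(f)` is finite. (On a bounded `Ω` the last condition holds for every bounded
`f`, whatever `σ` is.) -/
def signals (σ : ℝ → ℝ) (Ω : Set (E d)) : Set (SignedMeasure (E d)) :=
  {μ | CompactlySupportedIn Ω μ ∧
    μ ≪ᵥ (volume : Measure (E d)).toENNRealVectorMeasure ∧
    IntegrableOn (fun t => σ (density μ t)) Ω}

/-- The normalization operator on functions:
`(P_σ f)(t) = (σ(f(t)) + c) / ∫_Ω (σ(f(τ)) + c) dτ`. -/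
def normalize (σ : ℝ → ℝ) (c : ℝ) (Ω : Set (E d)) (f : E d → ℝ) (t : E d) : ℝ :=
  (σ (f t) + c) / ∫ τ in Ω, (σ (f τ) + c)

/-- The measure on `Ω` whose density is `P_σ f`, where `f` is the density of `μ`. -/
def normalizedMeasure (σ : ℝ → ℝ) (c : ℝ) (Ω : Set (E d)) (μ : SignedMeasure (E d)) :
    Measure (E d) :=
  (volume.restrict Ω).withDensity fun t => ENNReal.ofReal (normalize σ c Ω (density μ) t)

/-- `W_σ(f, g) = W₂(P_σ f, P_σ g)`. -/
def Wsigma (σ : ℝ → ℝ) (c : ℝ) (Ω : Set (E d)) (μ ν : SignedMeasure (E d)) : ℝ≥0∞ :=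
  W2 (normalizedMeasure σ c Ω μ) (normalizedMeasure σ c Ω ν)

end SignedW2

end

/-!
`W_σ` is the pull-back of `W₂` along `P_σ`, so it is a metric as soon as `W₂` is a finite metric on
the measures `P_σ μ` and `P_σ` is injective. The triangle inequality for `W₂` is Minkowski's
inequality for a gluing of two transference plans, obtained by disintegrating the second one over
the common marginal. If `W₂(μ, ν) = 0`, Chebyshev's inequality for nearly optimal plans gives
`μ F ≤ ν (thickening δ F) + δ²` for every `δ > 0`, hence `μ F ≤ ν F` for every closed `F`.

`P_σ` forgets only the normalizing constant, which can be recovered: two signals vanish off compact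
subsets of `Ω`, so they both vanish on a nonempty open part of `Ω`, where the densities of their
normalizations are `(σ 0 + c) / A` and `(σ 0 + c) / B`, with `A` and `B` the two constants.
-/

open Filter Metric Topology

namespace SignedW2

section Coupling

variable {α X : Type*} [MeasurableSpace α] [PseudoEMetricSpace X]

/-- The `L²` distance `(∫ |f - g|² dP)^{1/2}` of two maps into a metric space; `W₂(μ, ν)` is its
infimum over the couplings `(f, g)` of `μ` and `ν`. -/
noncomputable def l2Dist (P : Measure α) (f g : α → X) : ℝ≥0∞ :=
  (∫⁻ a, edist (f a) (g a) ^ 2 ∂P) ^ (1 / 2 : ℝ)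

variable (P : Measure α)

lemma l2Dist_self (f : α → X) : l2Dist P f f = 0 := by
  simp [l2Dist]

lemma l2Dist_comm (f g : α → X) : l2Dist P f g = l2Dist P g f := by
  simp only [l2Dist, edist_comm]

lemma l2Dist_sq (f g : α → X) : l2Dist P f g ^ 2 = ∫⁻ a, edist (f a) (g a) ^ 2 ∂P := by
  rw [l2Dist, ← ENNReal.rpow_two, ← ENNReal.rpow_mul]
  norm_num

variable [MeasurableSpace X]

lemma W2_eq_iInf_l2Dist (μ ν : Measure X) :
    W2 μ ν = ⨅ π : plans μ ν, l2Dist (π : Measure (X × X)) Prod.fst Prod.snd := by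
  rw [W2, iInf_subtype']
  exact (ENNReal.orderIsoRpow (1 / 2 : ℝ) (by norm_num)).map_iInf _

variable {P}

lemma W2_map_le_l2Dist {f g : α → X} (hf : Measurable f) (hg : Measurable g) :
    W2 (P.map f) (P.map g) ≤ l2Dist P f g := by
  have hplan : P.map (fun a => (f a, g a)) ∈ plans (P.map f) (P.map g) :=
    ⟨Measure.map_map measurable_fst (hf.prodMk hg), Measure.map_map measurable_snd (hf.prodMk hg)⟩
  rw [W2_eq_iInf_l2Dist]
  refine (iInf_le _ ⟨_, hplan⟩).trans ?_
  exact ENNReal.rpow_le_rpow (lintegral_map_le _ _) (by norm_num)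

lemma W2_self (μ : Measure X) : W2 μ μ = 0 := by
  simpa only [Measure.map_id, l2Dist_self, nonpos_iff_eq_zero] using
    W2_map_le_l2Dist (P := μ) measurable_id measurable_id

lemma W2_comm_le (μ ν : Measure X) : W2 μ ν ≤ W2 ν μ := by
  rw [W2_eq_iInf_l2Dist ν μ]
  refine le_iInf ?_
  rintro ⟨π, rfl, rfl⟩
  rw [l2Dist_comm]
  exact W2_map_le_l2Dist measurable_snd measurable_fst

lemma W2_comm (μ ν : Measure X) : W2 μ ν = W2 ν μ :=
  (W2_comm_le μ ν).antisymm (W2_comm_le ν μ)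

variable [OpensMeasurableSpace X] [SecondCountableTopology X]

lemma l2Dist_map {β : Type*} [MeasurableSpace β] {h : α → β} {f g : β → X} (hh : Measurable h)
    (hf : Measurable f) (hg : Measurable g) :
    l2Dist (P.map h) f g = l2Dist P (f ∘ h) (g ∘ h) := by
  simp only [l2Dist, Function.comp_apply]
  rw [lintegral_map (by fun_prop) hh]

lemma l2Dist_triangle {f g h : α → X} (hf : Measurable f) (hg : Measurable g)
    (hh : Measurable h) : l2Dist P f h ≤ l2Dist P f g + l2Dist P g h := by
  have minkowski := ENNReal.lintegral_Lp_add_le (μ := P) (p := 2)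
    (f := fun a => edist (f a) (g a)) (g := fun a => edist (g a) (h a))
    (by fun_prop) (by fun_prop) one_le_two
  simp only [ENNReal.rpow_two, Pi.add_apply] at minkowski
  refine le_trans ?_ minkowski
  unfold l2Dist
  gcongr
  exact edist_triangle _ _ _

lemma meas_le_edist_le_l2Dist_div_sq {f g : α → X} (hf : Measurable f) (hg : Measurable g)
    {δ : ℝ≥0∞} (hδ : δ ≠ 0) (hδ' : δ ≠ ⊤) :
    P {a | δ ≤ edist (f a) (g a)} ≤ (l2Dist P f g / δ) ^ 2 := by
  have chebyshev := meas_ge_le_lintegral_div (μ := P)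
    (f := fun a => edist (f a) (g a) ^ 2) (by fun_prop) (pow_ne_zero 2 hδ)
    (ENNReal.pow_ne_top hδ')
  rw [div_eq_mul_inv, mul_pow, ← ENNReal.inv_pow, ← div_eq_mul_inv, l2Dist_sq]
  exact (measure_mono fun a (ha : δ ≤ _) => pow_le_pow_left' ha 2).trans chebyshev

lemma map_le_map_thickening_add {f g : α → X} (hf : Measurable f) (hg : Measurable g)
    {δ : ℝ} (hδ : 0 < δ) {B : Set X} (hB : MeasurableSet B) :
    P.map f B ≤ P.map g (thickening δ B) + (l2Dist P f g / ENNReal.ofReal δ) ^ 2 := by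
  rw [Measure.map_apply hf hB, Measure.map_apply hg isOpen_thickening.measurableSet]
  have near_or_far : f ⁻¹' B ⊆
      g ⁻¹' thickening δ B ∪ {a | ENNReal.ofReal δ ≤ edist (f a) (g a)} := by
    intro a ha
    refine (lt_or_ge (edist (f a) (g a)) (ENNReal.ofReal δ)).imp_left fun h => ?_
    exact (mem_thickening_iff_exists_edist_lt _ _).2 ⟨f a, ha, edist_comm (f a) (g a) ▸ h⟩
  calc P (f ⁻¹' B)
      ≤ P (g ⁻¹' thickening δ B) + P {a | ENNReal.ofReal δ ≤ edist (f a) (g a)} :=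
        (measure_mono near_or_far).trans (measure_union_le _ _)
    _ ≤ _ := by
        gcongr
        exact meas_le_edist_le_l2Dist_div_sq hf hg (by simpa using hδ) ENNReal.ofReal_ne_top

end Coupling

section Gluing

variable {X Y Z : Type*} [MeasurableSpace X] [MeasurableSpace Y] [MeasurableSpace Z]

lemma exists_gluing [StandardBorelSpace Z] [Nonempty Z] {π₁ : Measure (X × Y)}
    {π₂ : Measure (Y × Z)} [SFinite π₁] [IsFiniteMeasure π₂]
    (h : π₁.map Prod.snd = π₂.map Prod.fst) :
    ∃ γ : Measure ((X × Y) × Z),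
      γ.map Prod.fst = π₁ ∧ γ.map (fun p => (p.1.2, p.2)) = π₂ := by
  refine ⟨π₁.compProd (π₂.condKernel.comap Prod.snd measurable_snd),
    Measure.fst_compProd _ _, ?_⟩
  have hproj : Measurable fun p : (X × Y) × Z => (p.1.2, p.2) := by fun_prop
  conv_rhs => rw [← π₂.disintegrate π₂.condKernel]
  ext s hs
  rw [Measure.map_apply hproj hs, Measure.compProd_apply (hproj hs), Measure.compProd_apply hs,
    Measure.fst, ← h,
    lintegral_map (ProbabilityTheory.Kernel.measurable_kernel_prodMk_left hs) measurable_snd]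
  rfl

end Gluing

section Wasserstein

variable {X : Type*} [MeasurableSpace X] [PseudoEMetricSpace X] [SecondCountableTopology X]

lemma W2_triangle [OpensMeasurableSpace X] [StandardBorelSpace X] (μ ν ρ : Measure X)
    [IsFiniteMeasure ν] : W2 μ ρ ≤ W2 μ ν + W2 ν ρ := by
  cases isEmpty_or_nonempty X
  · simp [Subsingleton.elim μ ρ, W2_self]
  rw [W2_eq_iInf_l2Dist μ ν, W2_eq_iInf_l2Dist ν ρ]
  refine ENNReal.le_iInf_add_iInf fun ⟨π₁, h₁, h₁'⟩ ⟨π₂, h₂, h₂'⟩ => ?_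
  have : IsFiniteMeasure (π₁.map Prod.snd) := h₁' ▸ inferInstance
  have : IsFiniteMeasure (π₂.map Prod.fst) := h₂ ▸ inferInstance
  have := Measure.isFiniteMeasure_of_map (μ := π₁) measurable_snd.aemeasurable
  have := Measure.isFiniteMeasure_of_map (μ := π₂) measurable_fst.aemeasurable
  obtain ⟨γ, rfl, rfl⟩ := exists_gluing (h₁'.trans h₂.symm)
  rw [Measure.map_map (by fun_prop) (by fun_prop)] at h₁ h₂'
  rw [l2Dist_map (by fun_prop) (by fun_prop) (by fun_prop),
    l2Dist_map (by fun_prop) (by fun_prop) (by fun_prop), ← h₁, ← h₂']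
  exact (W2_map_le_l2Dist (by fun_prop) (by fun_prop)).trans
    (l2Dist_triangle (by fun_prop) (by fun_prop) (by fun_prop))

lemma W2_lt_top [OpensMeasurableSpace X] {μ ν : Measure X} [IsProbabilityMeasure μ]
    [IsProbabilityMeasure ν] (x₀ : X) (hμ : ∫⁻ x, edist x x₀ ^ 2 ∂μ < ⊤)
    (hν : ∫⁻ x, edist x x₀ ^ 2 ∂ν < ⊤) : W2 μ ν < ⊤ := by
  have fst_lt : l2Dist (μ.prod ν) Prod.fst (fun _ => x₀) < ⊤ := by
    refine ENNReal.rpow_lt_top_of_nonneg (by norm_num) ?_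
    rw [measurePreserving_fst.lintegral_comp (f := fun x => edist x x₀ ^ 2) (by fun_prop)]
    exact hμ.ne
  have snd_lt : l2Dist (μ.prod ν) (fun _ => x₀) Prod.snd < ⊤ := by
    rw [l2Dist_comm]
    refine ENNReal.rpow_lt_top_of_nonneg (by norm_num) ?_
    rw [measurePreserving_snd.lintegral_comp (f := fun x => edist x x₀ ^ 2) (by fun_prop)]
    exact hν.ne
  calc W2 μ ν
      = W2 ((μ.prod ν).map Prod.fst) ((μ.prod ν).map Prod.snd) := by simp
    _ ≤ l2Dist (μ.prod ν) Prod.fst Prod.snd := W2_map_le_l2Dist measurable_fst measurable_snd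
    _ ≤ l2Dist (μ.prod ν) Prod.fst (fun _ => x₀) + l2Dist (μ.prod ν) (fun _ => x₀) Prod.snd :=
        l2Dist_triangle measurable_fst measurable_const measurable_snd
    _ < ⊤ := ENNReal.add_lt_top.2 ⟨fst_lt, snd_lt⟩

lemma measure_le_measure_thickening_add_of_W2_lt [OpensMeasurableSpace X] {μ ν : Measure X}
    {δ : ℝ} (hδ : 0 < δ) {r : ℝ≥0∞} (h : W2 μ ν < r) {B : Set X} (hB : MeasurableSet B) :
    μ B ≤ ν (thickening δ B) + (r / ENNReal.ofReal δ) ^ 2 := by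
  rw [W2_eq_iInf_l2Dist, iInf_lt_iff] at h
  obtain ⟨⟨π, rfl, rfl⟩, hπ⟩ := h
  refine (map_le_map_thickening_add measurable_fst measurable_snd hδ hB).trans ?_
  gcongr

lemma measure_le_of_W2_eq_zero [OpensMeasurableSpace X] {μ ν : Measure X} [IsFiniteMeasure ν]
    (h : W2 μ ν = 0) {F : Set X} (hF : IsClosed F) : μ F ≤ ν F := by
  have bound : ∀ δ > 0, μ F ≤ ν (thickening δ F) + ENNReal.ofReal δ ^ 2 := by
    intro δ hδ
    have hδ₀ : ENNReal.ofReal δ ≠ 0 := by simpa using hδ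
    have hlt : W2 μ ν < ENNReal.ofReal δ * ENNReal.ofReal δ :=
      h ▸ ENNReal.mul_pos hδ₀ hδ₀
    have := measure_le_measure_thickening_add_of_W2_lt hδ hlt hF.measurableSet
    rwa [ENNReal.mul_div_cancel_right hδ₀ ENNReal.ofReal_ne_top] at this
  have thickening_lim : Tendsto (fun δ => ν (thickening δ F)) (𝓝[>] 0) (𝓝 (ν F)) :=
    tendsto_measure_thickening_of_isClosed ⟨1, one_pos, measure_ne_top _ _⟩ hF
  have error_lim : Tendsto (fun δ => ENNReal.ofReal δ ^ 2) (𝓝[>] 0) (𝓝 0) := by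
    have : Continuous fun δ => ENNReal.ofReal δ ^ 2 :=
      (ENNReal.continuous_pow 2).comp ENNReal.continuous_ofReal
    simpa using (this.tendsto 0).mono_left nhdsWithin_le_nhds
  refine ge_of_tendsto (by simpa using thickening_lim.add error_lim) ?_
  filter_upwards [self_mem_nhdsWithin] with δ hδ using bound δ hδ

lemma W2_eq_zero_iff [BorelSpace X] {μ ν : Measure X} [IsFiniteMeasure ν] :
    W2 μ ν = 0 ↔ μ = ν := by
  refine ⟨fun h => ?_, fun h => h ▸ W2_self μ⟩
  have : IsFiniteMeasure μ :=
    ⟨(measure_le_of_W2_eq_zero h isClosed_univ).trans_lt (measure_lt_top ν _)⟩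
  have hF : ∀ F, IsClosed F → μ F = ν F := fun F hF =>
    (measure_le_of_W2_eq_zero h hF).antisymm (measure_le_of_W2_eq_zero (W2_comm ν μ ▸ h) hF)
  exact ext_of_generate_finite _ (BorelSpace.measurable_eq.trans borel_eq_generateFrom_isClosed)
    isPiSystem_isClosed hF (hF _ isClosed_univ)

lemma exists_metricSpace_edist_eq_W2 [BorelSpace X] [StandardBorelSpace X] {T : Type*}
    {Φ : T → Measure X} [∀ t, IsFiniteMeasure (Φ t)] (hΦ : Function.Injective Φ)
    (hfin : ∀ s t, W2 (Φ s) (Φ t) < ⊤) :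
    ∃ m : MetricSpace T, ∀ s t, m.edist s t = W2 (Φ s) (Φ t) :=
  let e : EMetricSpace T :=
    { edist := fun s t => W2 (Φ s) (Φ t)
      edist_self := fun _ => W2_self _
      edist_comm := fun _ _ => W2_comm _ _
      edist_triangle := fun _ _ _ => W2_triangle _ _ _
      eq_of_edist_eq_zero := fun h => hΦ (W2_eq_zero_iff.1 h) }
  ⟨EMetricSpace.toMetricSpace fun s t => (hfin s t).ne, fun _ _ => rfl⟩

end Wasserstein

section MeasureTheory

variable {α : Type*} [MeasurableSpace α] {m : Measure α}

lemma integral_pos_of_forall_pos [NeZero m] {h : α → ℝ} (hint : Integrable h m)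
    (hpos : ∀ a, 0 < h a) : 0 < ∫ a, h a ∂m := by
  have hsupp : Function.support h = univ := eq_univ_of_forall fun a => (hpos a).ne'
  rw [integral_pos_iff_support_of_nonneg (fun a => (hpos a).le) hint, hsupp]
  exact NeZero.pos _

lemma isProbabilityMeasure_withDensity_div_integral {h : α → ℝ} (hnonneg : 0 ≤ᵐ[m] h)
    (hint : ∫ a, h a ∂m ≠ 0) :
    IsProbabilityMeasure (m.withDensity fun a => ENNReal.ofReal (h a / ∫ b, h b ∂m)) := by
  refine ⟨?_⟩
  rw [withDensity_apply _ MeasurableSet.univ, Measure.restrict_univ,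
    ← ofReal_integral_eq_lintegral_ofReal ((Integrable.of_integral_ne_zero hint).div_const _),
    integral_div, div_self hint, ENNReal.ofReal_one]
  filter_upwards [hnonneg] with a ha using div_nonneg ha (integral_nonneg_of_ae hnonneg)

lemma lintegral_enorm_pow_lt_top_of_ae_mem_isBounded {F : Type*} [SeminormedAddCommGroup F]
    [MeasurableSpace F] {ρ : Measure F} [IsFiniteMeasure ρ] {s : Set F}
    (hs : Bornology.IsBounded s) (hρ : ∀ᵐ x ∂ρ, x ∈ s) (n : ℕ) : ∫⁻ x, ‖x‖ₑ ^ n ∂ρ < ⊤ := by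
  obtain ⟨R, hR⟩ := hs.exists_norm_le
  calc ∫⁻ x, ‖x‖ₑ ^ n ∂ρ
      ≤ ∫⁻ _, ENNReal.ofReal R ^ n ∂ρ := by
        refine lintegral_mono_ae ?_
        filter_upwards [hρ] with x hx
        gcongr
        exact ofReal_norm x ▸ ENNReal.ofReal_le_ofReal (hR x hx)
    _ < ⊤ := by
        rw [lintegral_const]
        exact ENNReal.mul_lt_top (ENNReal.pow_lt_top ENNReal.ofReal_lt_top) (measure_lt_top _ _)

lemma ae_rnDeriv_eq_zero_of_notMem [SigmaFinite m] {s : SignedMeasure α}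
    (hs : s ≪ᵥ m.toENNRealVectorMeasure) {K : Set α} (hK : MeasurableSet K)
    (hsK : ∀ A, MeasurableSet A → Disjoint A K → s A = 0) :
    ∀ᵐ a ∂m, a ∉ K → s.rnDeriv m a = 0 := by
  have hint := SignedMeasure.integrable_rnDeriv s m
  refine (ae_restrict_iff' hK.compl).1 ?_
  refine hint.integrableOn.ae_eq_zero_of_forall_setIntegral_eq_zero fun A hA _ => ?_
  rw [Measure.restrict_restrict hA, ← withDensityᵥ_apply hint (hA.inter hK.compl),
    SignedMeasure.withDensityᵥ_rnDeriv_eq s m hs]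
  exact hsK _ (hA.inter hK.compl) (disjoint_compl_left.mono_left inter_subset_right)

end MeasureTheory

lemma nonempty_diff_of_isCompact {X : Type*} [TopologicalSpace X] [T2Space X]
    [PreconnectedSpace X] [NoncompactSpace X] {U K : Set X} (hU : IsOpen U) (hne : U.Nonempty)
    (hK : IsCompact K) (hKU : K ⊆ U) : (U \ K).Nonempty := by
  rw [sdiff_nonempty]
  intro hUK
  obtain rfl := hUK.antisymm hKU
  exact noncompact_univ X (IsClopen.eq_univ ⟨hK.isClosed, hU⟩ hne ▸ hK)

section Signals

variable {d : ℕ} {Ω : Set (E d)} {σ : ℝ → ℝ} {c : ℝ} {f g : E d → ℝ} {μ ν : SignedMeasure (E d)}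

lemma integral_eq_of_normalize_ae_eq (h0 : σ 0 + c ≠ 0)
    (hfg : ∀ᵐ t ∂volume.restrict Ω, normalize σ c Ω f t = normalize σ c Ω g t)
    (hzero : ∃ᵐ t ∂volume.restrict Ω, f t = 0 ∧ g t = 0) :
    ∫ t in Ω, (σ (f t) + c) = ∫ t in Ω, (σ (g t) + c) := by
  obtain ⟨t, ⟨hft, hgt⟩, ht⟩ := (hzero.and_eventually hfg).exists
  rw [normalize, normalize, hft, hgt, div_eq_mul_inv, div_eq_mul_inv] at ht
  exact inv_injective (mul_left_cancel₀ h0 ht)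

lemma ae_eq_of_normalize_ae_eq (hσ : Function.Injective σ) (h0 : σ 0 + c ≠ 0)
    (hg : ∫ t in Ω, (σ (g t) + c) ≠ 0)
    (hfg : ∀ᵐ t ∂volume.restrict Ω, normalize σ c Ω f t = normalize σ c Ω g t)
    (hzero : ∃ᵐ t ∂volume.restrict Ω, f t = 0 ∧ g t = 0) :
    f =ᵐ[volume.restrict Ω] g := by
  filter_upwards [hfg] with t ht
  rw [normalize, normalize, integral_eq_of_normalize_ae_eq h0 hfg hzero, div_left_inj' hg] at ht
  exact hσ (add_right_cancel ht)

lemma exists_isCompact_ae_density_eq_zero (hμ : μ ∈ signals σ Ω) :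
    ∃ K ⊆ Ω, IsCompact K ∧ ∀ᵐ t, t ∉ K → density μ t = 0 := by
  obtain ⟨⟨K, hK, hKΩ, hμK⟩, hac, -⟩ := hμ
  exact ⟨K, hKΩ, hK, ae_rnDeriv_eq_zero_of_notMem hac hK.measurableSet hμK⟩

lemma frequently_density_eq_zero [NeZero d] (hΩ : IsOpen Ω) (hne : Ω.Nonempty)
    (hμ : μ ∈ signals σ Ω) (hν : ν ∈ signals σ Ω) :
    ∃ᵐ t ∂volume.restrict Ω, density μ t = 0 ∧ density ν t = 0 := by
  obtain ⟨K, hKΩ, hK, hμK⟩ := exists_isCompact_ae_density_eq_zero hμ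
  obtain ⟨L, hLΩ, hL, hνL⟩ := exists_isCompact_ae_density_eq_zero hν
  have hKL : IsCompact (K ∪ L) := hK.union hL
  have hvol : volume.restrict Ω (Ω \ (K ∪ L)) ≠ 0 := by
    rw [Measure.restrict_eq_self _ sdiff_subset]
    exact ((hΩ.sdiff hKL.isClosed).measure_pos volume
      (nonempty_diff_of_isCompact hΩ hne hKL (union_subset hKΩ hLΩ))).ne'
  refine ((frequently_ae_mem_iff.2 hvol).and_eventually
    (ae_restrict_of_ae (hμK.and hνL))).mono ?_
  rintro t ⟨ht, htK, htL⟩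
  exact ⟨htK fun h => ht.2 (Or.inl h), htL fun h => ht.2 (Or.inr h)⟩

lemma eq_of_density_ae_eq_restrict (hΩ : MeasurableSet Ω) (hμ : μ ∈ signals σ Ω)
    (hν : ν ∈ signals σ Ω) (h : density μ =ᵐ[volume.restrict Ω] density ν) : μ = ν := by
  obtain ⟨K, hKΩ, -, hμK⟩ := exists_isCompact_ae_density_eq_zero hμ
  obtain ⟨L, hLΩ, -, hνL⟩ := exists_isCompact_ae_density_eq_zero hν
  rw [← SignedMeasure.withDensityᵥ_rnDeriv_eq μ volume hμ.2.1,
    ← SignedMeasure.withDensityᵥ_rnDeriv_eq ν volume hν.2.1]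
  refine WithDensityᵥEq.congr_ae ?_
  filter_upwards [(ae_restrict_iff' hΩ).1 h, hμK, hνL] with t hΩt hKt hLt
  by_cases ht : t ∈ Ω
  · exact hΩt ht
  · exact (hKt fun h => ht (hKΩ h)).trans (hLt fun h => ht (hLΩ h)).symm

lemma integrableOn_sigma_density_add (hbdd : Bornology.IsBounded Ω) (hμ : μ ∈ signals σ Ω) :
    IntegrableOn (fun t => σ (density μ t) + c) Ω :=
  hμ.2.2.add (integrableOn_const hbdd.measure_lt_top.ne)

lemma integral_sigma_density_add_pos (hΩ : IsOpen Ω) (hne : Ω.Nonempty)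
    (hbdd : Bornology.IsBounded Ω) (hpos : ∀ y, 0 < σ y + c) (hμ : μ ∈ signals σ Ω) :
    0 < ∫ t in Ω, (σ (density μ t) + c) := by
  have : NeZero (volume.restrict Ω) :=
    ⟨mt Measure.restrict_eq_zero.1 (hΩ.measure_pos volume hne).ne'⟩
  exact integral_pos_of_forall_pos (integrableOn_sigma_density_add hbdd hμ) fun t => hpos _

lemma isProbabilityMeasure_normalizedMeasure (hΩ : IsOpen Ω) (hne : Ω.Nonempty)
    (hbdd : Bornology.IsBounded Ω) (hpos : ∀ y, 0 < σ y + c) (hμ : μ ∈ signals σ Ω) :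
    IsProbabilityMeasure (normalizedMeasure σ c Ω μ) :=
  isProbabilityMeasure_withDensity_div_integral (ae_of_all _ fun t => (hpos (density μ t)).le)
    (integral_sigma_density_add_pos hΩ hne hbdd hpos hμ).ne'

lemma ae_mem_normalizedMeasure (hΩ : MeasurableSet Ω) :
    ∀ᵐ x ∂normalizedMeasure σ c Ω μ, x ∈ Ω :=
  (withDensity_absolutelyContinuous _ _).ae_le (ae_restrict_mem hΩ)

lemma normalize_ae_eq_of_normalizedMeasure_eq (hbdd : Bornology.IsBounded Ω)
    (hnonneg : ∀ y, 0 ≤ σ y + c) (hμ : μ ∈ signals σ Ω) (hν : ν ∈ signals σ Ω)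
    (h : normalizedMeasure σ c Ω μ = normalizedMeasure σ c Ω ν) :
    ∀ᵐ t ∂volume.restrict Ω, normalize σ c Ω (density μ) t = normalize σ c Ω (density ν) t := by
  have measurable_normalize {ρ : SignedMeasure (E d)} (hρ : ρ ∈ signals σ Ω) :
      AEMeasurable (fun t => ENNReal.ofReal (normalize σ c Ω (density ρ) t))
        (volume.restrict Ω) :=
    ((integrableOn_sigma_density_add hbdd hρ).div_const _).aemeasurable.ennreal_ofReal
  have normalize_nonneg (f : E d → ℝ) (t : E d) : 0 ≤ normalize σ c Ω f t :=
    div_nonneg (hnonneg _) (integral_nonneg fun _ => hnonneg _)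
  filter_upwards [(withDensity_eq_iff_of_sigmaFinite (measurable_normalize hμ)
    (measurable_normalize hν)).1 h] with t ht
  exact (ENNReal.ofReal_eq_ofReal_iff (normalize_nonneg _ t) (normalize_nonneg _ t)).1 ht

lemma injOn_normalizedMeasure [NeZero d] (hΩ : IsOpen Ω) (hne : Ω.Nonempty)
    (hbdd : Bornology.IsBounded Ω) (hpos : ∀ y, 0 < σ y + c) (hσ : Function.Injective σ) :
    InjOn (normalizedMeasure σ c Ω) (signals σ Ω) := by
  intro μ hμ ν hν h
  refine eq_of_density_ae_eq_restrict hΩ.measurableSet hμ hν ?_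
  exact ae_eq_of_normalize_ae_eq hσ (hpos 0).ne'
    (integral_sigma_density_add_pos hΩ hne hbdd hpos hν).ne'
    (normalize_ae_eq_of_normalizedMeasure_eq hbdd (fun y => (hpos y).le) hμ hν h)
    (frequently_density_eq_zero hΩ hne hμ hν)

end Signals

end SignedW2

open SignedW2 in
theorem theorem4p1_general {d : ℕ} [NeZero d] {Ω : Set (E d)} (hΩ_open : IsOpen Ω)
    (hΩ_nonempty : Ω.Nonempty) (hΩ_bounded : Bornology.IsBounded Ω) {σ : ℝ → ℝ} {c : ℝ}
    (hσ_pos : ∀ y, 0 < σ y + c) (hσ_inj : Function.Injective σ) :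
    (∀ μ ∈ signals σ Ω, IsProbabilityMeasure (normalizedMeasure σ c Ω μ) ∧
      ∫⁻ x, ‖x‖ₑ ^ 2 ∂(normalizedMeasure σ c Ω μ) < ⊤) ∧
    ∃ m : MetricSpace (signals σ Ω), ∀ μ ν : signals σ Ω, m.edist μ ν = Wsigma σ c Ω μ ν := by
  have hprob (μ : signals σ Ω) : IsProbabilityMeasure (normalizedMeasure σ c Ω μ) :=
    isProbabilityMeasure_normalizedMeasure hΩ_open hΩ_nonempty hΩ_bounded hσ_pos μ.2
  have hmoment (μ : signals σ Ω) : ∫⁻ x, ‖x‖ₑ ^ 2 ∂(normalizedMeasure σ c Ω μ) < ⊤ :=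
    lintegral_enorm_pow_lt_top_of_ae_mem_isBounded hΩ_bounded
      (ae_mem_normalizedMeasure hΩ_open.measurableSet) 2
  refine ⟨fun μ hμ => ⟨hprob ⟨μ, hμ⟩, hmoment ⟨μ, hμ⟩⟩, ?_⟩
  refine exists_metricSpace_edist_eq_W2
    (injOn_normalizedMeasure hΩ_open hΩ_nonempty hΩ_bounded hσ_pos hσ_inj).injective ?_
  intro μ ν
  exact W2_lt_top 0 (by simpa using hmoment μ) (by simpa using hmoment ν)

/-- On a bounded nonempty open set `Ω ⊆ ℝ^d`, `d ≥ 1`, the operator `P_σ` turns signals into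
probability densities with finite second moment, and `W_σ` is a (finite) metric on the signals. -/
theorem theorem4p1 (d : ℕ) (hd : 1 ≤ d) (Ω : Set (SignedW2.E d)) (hΩ_open : IsOpen Ω)
    (hΩ_nonempty : Ω.Nonempty) (hΩ_bounded : Bornology.IsBounded Ω)
    (σ : ℝ → ℝ) (hσ : SignedW2.IsScaling σ) (c : ℝ) (hc : 0 ≤ c) :
    (∀ μ ∈ SignedW2.signals σ Ω,
      IsProbabilityMeasure (SignedW2.normalizedMeasure σ c Ω μ) ∧
      ∫⁻ x, ‖x‖ₑ ^ 2 ∂(SignedW2.normalizedMeasure σ c Ω μ) < ⊤) ∧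
    ∃ m : MetricSpace (SignedW2.signals σ Ω),
      ∀ μ ν : SignedW2.signals σ Ω, m.edist μ ν = SignedW2.Wsigma σ c Ω μ ν := by
  have : NeZero d := ⟨by lia⟩
  exact theorem4p1_general hΩ_open hΩ_nonempty hΩ_bounded
    (fun y => add_pos_of_pos_of_nonneg (hσ.pos y) hc) hσ.injective
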